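/- Let $n\ge 1$, let $M\subset\mathbb{R}^n$ be compact and convex, and let $m$ be a probability measure that is absolutely continuous with respect to Lebesgue measure and whose topological support is $M$. For $\varphi:M\to\mathbb{R}$ put $$\varphi^{\mathfrak c}(x)=-\inf_{y\in M}\Big[\tfrac12|x-y|^2+\varphi(y)\Big],\qquad x\in M,$$ and call $\varphi$ $d^2/2$-convex if $\varphi=\psi^{\mathfrak c}$ for some $\psi:M\to\mathbb{R}$. For every probability measure $\mu$ on $M$ there is a $d^2/2$-convex function $\varphi$ on $M$, unique up to an additive constant, with $(\mathrm{Id}+\nabla\varphi)_*m=\mu$ (Brenier–McCann); the conjugate measure of $\mu$ is $$\mu^{\mathfrak c}:=(\mathrm{Id}+\nabla\varphi^{\mathfrak c})_*m .$$ Let $\mu$ be a probability measure on $M$. (i) If $\mu$ is discrete, that is, $\mu=\sum_{i=1}^N\lambda_i\delta_{z_i}$ with $N\in\mathbb{N}\cup\{\infty\}$, then the topological support of $\mu^{\mathfrak c}$ is an $m$-null set. In particular, $\mu^{\mathfrak c}$ has no absolutely continuous part with respect to $m$: every measure $\nu\le\mu^{\mathfrak c}$ with $\nu\ll m$ is zero.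 (ii) If $\mu$ has full topological support, that is, $\operatorname{supp}\mu=M$, then $\mu^{\mathfrak c}$ has no atoms: $\mu^{\mathfrak c}(\{x\})=0$ for every $x$. -/

import Mathlib

open MeasureTheory Set
open scoped ENNReal

noncomputable section

/-- The conjugate (generalized Legendre transform)
`φᶜ(x) = - inf_{y ∈ M} [d(x,y)² / 2 + φ(y)]` of a function on `M`.
Only the values of `φ` on `M` are used. -/
def conjFun {n : ℕ} (M : Set (EuclideanSpace ℝ (Fin n))) (φ : EuclideanSpace ℝ (Fin n) → ℝ) :
    EuclideanSpace ℝ (Fin n) → ℝ :=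
  fun x => -sInf ((fun y => dist x y ^ 2 / 2 + φ y) '' M)

/-- `φ : M → ℝ` is `d²/2`-convex: there is `ψ : M → ℝ` such that
`φ(x) = - inf_{y ∈ M} [d(x,y)² / 2 + ψ(y)]` for all `x ∈ M`, where the infimum is an actual
(finite) greatest lower bound.  Only the values of `φ` and `ψ` on `M` are used. -/
def IsHalfSqDistConvex {n : ℕ} (M : Set (EuclideanSpace ℝ (Fin n)))
    (φ : EuclideanSpace ℝ (Fin n) → ℝ) : Prop :=
  ∃ ψ : EuclideanSpace ℝ (Fin n) → ℝ, ∀ x ∈ M,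
    IsGLB ((fun y => dist x y ^ 2 / 2 + ψ y) '' M) (-φ x)

/-- The map `exp(∇φ) : x ↦ x + ∇φ(x)`.  On the interior of `M` the gradient within `M` is the
usual gradient. -/
def expGrad {n : ℕ} (M : Set (EuclideanSpace ℝ (Fin n))) (φ : EuclideanSpace ℝ (Fin n) → ℝ) :
    EuclideanSpace ℝ (Fin n) → EuclideanSpace ℝ (Fin n) :=
  fun x => x + gradientWithin φ M x

/-- A potential of the Brenier map from `m` to `μ`: a `d²/2`-convex function `φ` on `M` with
`exp(∇φ)_* m = μ`.  When `m` is absolutely continuous with support `M`, it exists for every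
probability measure `μ` on `M` and is unique on `M` up to an additive constant. -/
def brenierPotential {n : ℕ} (M : Set (EuclideanSpace ℝ (Fin n)))
    (m μ : Measure (EuclideanSpace ℝ (Fin n))) : EuclideanSpace ℝ (Fin n) → ℝ :=
  Classical.epsilon fun φ => IsHalfSqDistConvex M φ ∧ m.map (expGrad M φ) = μ

/-- The conjugate measure `μᶜ = exp(∇φᶜ)_* m`, where `exp(∇φ)` is the Brenier map
from `m` to `μ`. -/
def conjMeasure {n : ℕ} (M : Set (EuclideanSpace ℝ (Fin n)))
    (m μ : Measure (EuclideanSpace ℝ (Fin n))) : Measure (EuclideanSpace ℝ (Fin n)) :=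
  m.map (expGrad M (conjFun M (brenierPotential M m μ)))

/-- `μ` is discrete: a finite or countable sum `∑ λ_i δ_{z_i}` of weighted point masses. -/
def IsDiscreteMeasure {n : ℕ} (μ : Measure (EuclideanSpace ℝ (Fin n))) : Prop :=
  ∃ (c : ℕ → ℝ≥0∞) (z : ℕ → EuclideanSpace ℝ (Fin n)),
    μ = Measure.sum fun i => c i • Measure.dirac (z i)

end

/-!
For a continuous function `f` on `M` let `f* (x) = sup_{y ∈ M} (⟪x, y⟫ - f y)`. Up to the terms
`‖·‖² / 2`, a `d² / 2`-convex function and its conjugate are `f*` and `g*` for a pair of functions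
on `M` with `g = f*` and `f = g*` on `M`, so the transport maps to `μ` and `μᶜ` are `∇f*` and `∇g*`.
Where `f*` is differentiable, `∇f* (x)` is the only `y` with `x ∈ ∂f(y)`, and for `x, y ∈ M`
the relations `x ∈ ∂f(y)` and `y ∈ ∂g(x)` are the same.

The sets `∂f(y)` are convex, so their boundaries are null, and a point interior to `∂f(y)` lies in
no other `∂f(z)`. If `μ` lives on a countable set `D`, the interiors of `∂f(z)`, `z ∈ D`, form an
open set of full measure, and `∇g* (y)` can only meet it for `y ∈ D`. If `μᶜ` had an atom at `x`,
the interior of `∂g(x)` would meet `M = supp μ`, while `∇f*` enters it only at `x`.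

The transport map itself exists because `f ↦ ∫ f* dm + ∫ f dμ` attains its minimum: by Danskin's
theorem its Euler–Lagrange equation says that `∇f*` pushes `m` forward to `μ`.
-/

open Filter Topology Metric
open scoped RealInnerProductSpace NNReal BoundedContinuousFunction

section Legendre

variable {E : Type*} [NormedAddCommGroup E] [InnerProductSpace ℝ E] {M : Set E}

/-- The Legendre transform relative to `M` of a function on `M`. It is a junk value where the
supremum is infinite. -/
noncomputable def legendre (f : M → ℝ) (x : E) : ℝ := ⨆ y : M, (⟪x, (y : E)⟫ - f y)

/-- The subdifferential relative to `M` of a function on `M`: the slopes of the affine minorants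
that touch `f` at `y`. -/
def subdifferential (f : M → ℝ) (y : M) : Set E := {x | ∀ z : M, f y + ⟪x, (z : E) - y⟫ ≤ f z}

theorem convex_subdifferential (f : M → ℝ) (y : M) : Convex ℝ (subdifferential f y) := by
  have h : subdifferential f y = ⋂ z : M, {x | ⟪(z : E) - y, x⟫ ≤ f z - f y} := by
    ext x
    simp only [subdifferential, mem_ofPred_eq, mem_iInter, le_sub_iff_add_le', real_inner_comm]
  rw [h]
  exact convex_iInter fun z => convex_halfSpace_le (innerSL ℝ ((z : E) - y)).isLinear _

theorem inner_sub_sub_nonneg_of_mem_subdifferential {f : M → ℝ} {x x' : E} {y y' : M}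
    (hx : x ∈ subdifferential f y) (hx' : x' ∈ subdifferential f y') :
    0 ≤ ⟪x - x', (y : E) - y'⟫ := by
  have h := hx y'
  have h' := hx' y
  simp only [inner_sub_left, inner_sub_right] at h h' ⊢
  linarith

theorem eq_of_mem_interior_subdifferential {f : M → ℝ} {x : E} {y z : M}
    (hy : x ∈ interior (subdifferential f y)) (hz : x ∈ subdifferential f z) : z = y := by
  have hmin : IsLocalMin (fun p => ⟪(y : E) - z, p⟫) x := by
    filter_upwards [mem_interior_iff_mem_nhds.1 hy] with p hp
    have := inner_sub_sub_nonneg_of_mem_subdifferential hp hz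
    rwa [real_inner_comm, inner_sub_right, sub_nonneg] at this
  have hzero := hmin.hasFDerivAt_eq_zero (innerSL ℝ ((y : E) - z)).hasFDerivAt
  have hnorm : ⟪(y : E) - z, (y : E) - z⟫ = 0 := DFunLike.congr_fun hzero ((y : E) - z)
  rw [inner_self_eq_zero, sub_eq_zero] at hnorm
  exact Subtype.ext hnorm.symm

theorem legendre_le [Nonempty M] {f : M → ℝ} {x : E} {c : ℝ}
    (h : ∀ y : M, ⟪x, (y : E)⟫ ≤ c + f y) : legendre f x ≤ c :=
  ciSup_le fun y => sub_le_iff_le_add.2 (h y)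

theorem lipschitzOnWith_legendre [Nonempty M] {R : ℝ≥0} (hR : M ⊆ closedBall 0 R) {f : M → ℝ}
    {s : Set E} (hf : ∀ x ∈ s, BddAbove (range fun y : M => ⟪x, (y : E)⟫ - f y)) :
    LipschitzOnWith R (legendre f) s := by
  refine LipschitzOnWith.of_le_add_mul R fun x _ x' hx' => legendre_le fun y => ?_
  have hx'y : ⟪x', (y : E)⟫ - f y ≤ legendre f x' := le_ciSup (hf x' hx') y
  have hxx' : ⟪x - x', (y : E)⟫ ≤ R * dist x x' := by
    rw [dist_eq_norm, mul_comm]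
    exact (real_inner_le_norm _ _).trans <|
      mul_le_mul_of_nonneg_left (mem_closedBall_zero_iff.1 (hR y.2)) (norm_nonneg _)
  rw [inner_sub_left] at hxx'
  linarith

section Compact

variable [CompactSpace M]

theorem bddAbove_range_inner_sub (f : C(M, ℝ)) (x : E) :
    BddAbove (range fun y : M => ⟪x, (y : E)⟫ - f y) :=
  (isCompact_range (by fun_prop)).bddAbove

theorem inner_le_legendre_add (f : C(M, ℝ)) (x : E) (y : M) : ⟪x, (y : E)⟫ ≤ legendre f x + f y :=
  sub_le_iff_le_add.1 (le_ciSup (bddAbove_range_inner_sub f x) y)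

variable [Nonempty M]

theorem mem_subdifferential_iff {f : C(M, ℝ)} {x : E} {y : M} :
    x ∈ subdifferential f y ↔ legendre f x + f y = ⟪x, (y : E)⟫ := by
  constructor
  · intro h
    refine (inner_le_legendre_add f x y).antisymm' (le_sub_iff_add_le.1 (legendre_le fun z => ?_))
    have := h z
    rw [inner_sub_right] at this
    linarith
  · intro h z
    have := inner_le_legendre_add f x z
    rw [inner_sub_right]
    linarith

theorem exists_mem_subdifferential (f : C(M, ℝ)) (x : E) : ∃ y : M, x ∈ subdifferential f y := by
  obtain ⟨y, -, hy⟩ := isCompact_univ.exists_isMaxOn univ_nonempty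
    (f := fun y : M => ⟪x, (y : E)⟫ - f y) (by fun_prop)
  refine ⟨y, fun z => ?_⟩
  have : ⟪x, (z : E)⟫ - f z ≤ ⟪x, (y : E)⟫ - f y := hy (mem_univ z)
  rw [inner_sub_right]
  linarith

theorem exists_forall_lipschitzWith_legendre :
    ∃ R : ℝ≥0, ∀ f : C(M, ℝ), LipschitzWith R (legendre f) := by
  have hM : IsCompact M := isCompact_iff_compactSpace.2 ‹CompactSpace M›
  obtain ⟨R, hR0, hR⟩ := hM.isBounded.subset_closedBall_lt 0 0
  exact ⟨⟨R, hR0.le⟩, fun f => lipschitzOnWith_univ.1 <|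
    lipschitzOnWith_legendre hR fun x _ => bddAbove_range_inner_sub f x⟩

theorem continuous_legendre (f : C(M, ℝ)) : Continuous (legendre f) :=
  (exists_forall_lipschitzWith_legendre.choose_spec f).continuous

theorem gradient_legendre_eq [CompleteSpace E] {f : C(M, ℝ)} {x : E} {y : M}
    (hy : x ∈ subdifferential f y) (hd : DifferentiableAt ℝ (legendre f) x) :
    gradient (legendre f) x = y := by
  have hmin : IsLocalMin (fun p => legendre f p - ⟪(y : E), p⟫) x := by
    refine Eventually.of_forall fun p => ?_
    have hp := inner_le_legendre_add f p y
    have hx := mem_subdifferential_iff.1 hy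
    rw [real_inner_comm] at hp hx
    linarith
  have hzero := hmin.hasFDerivAt_eq_zero (hd.hasFDerivAt.sub (innerSL ℝ (y : E)).hasFDerivAt)
  rw [sub_eq_zero] at hzero
  rw [gradient, hzero]
  exact (InnerProductSpace.toDual ℝ E).symm_apply_apply y

theorem legendre_le_legendre_add_dist (f g : C(M, ℝ)) (x : E) :
    legendre f x ≤ legendre g x + dist f g :=
  legendre_le fun y => by
    have hfg := (abs_le.1 (ContinuousMap.dist_apply_le_dist (f := f) (g := g) y)).1
    linarith [inner_le_legendre_add g x y]

theorem abs_legendre_sub_legendre_le (f g : C(M, ℝ)) (x : E) :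
    |legendre f x - legendre g x| ≤ dist f g := by
  have hfg := legendre_le_legendre_add_dist f g x
  have hgf := legendre_le_legendre_add_dist g f x
  rw [dist_comm] at hgf
  exact abs_le.2 ⟨by linarith, by linarith⟩

/-- The Legendre transform relative to `M`, restricted to `M`. -/
noncomputable def conjugate (f : C(M, ℝ)) : C(M, ℝ) :=
  ⟨M.domRestrict (legendre f), (continuous_legendre f).comp continuous_subtype_val⟩

theorem conjugate_apply (f : C(M, ℝ)) (x : M) : conjugate f x = legendre f (x : E) := rfl

theorem conjugate_conjugate_le (f : C(M, ℝ)) (y : M) : conjugate (conjugate f) y ≤ f y :=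
  legendre_le fun x => by
    rw [real_inner_comm, conjugate_apply, add_comm]
    exact inner_le_legendre_add f x y

theorem conjugate_conjugate_of_isLUB {p : C(M, ℝ)} {f : M → ℝ}
    (hp : ∀ x : M, IsLUB (range fun y : M => ⟪(x : E), (y : E)⟫ - f y) (p x)) :
    conjugate (conjugate p) = p := by
  ext x
  refine (conjugate_conjugate_le p x).antisymm ((hp x).2 ?_)
  rintro _ ⟨y, rfl⟩
  have hpf : conjugate p y ≤ f y := legendre_le fun z => by
    have := (hp z).1 (mem_range_self y)
    rw [real_inner_comm]
    linarith
  have := inner_le_legendre_add (conjugate p) (x : E) y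
  rw [← conjugate_apply] at this
  linarith

theorem conjugate_conjugate_conjugate (f : C(M, ℝ)) :
    conjugate (conjugate (conjugate f)) = conjugate f :=
  conjugate_conjugate_of_isLUB fun x => isLUB_ciSup (bddAbove_range_inner_sub f x)

theorem mem_subdifferential_conjugate_iff {f : C(M, ℝ)} (hf : conjugate (conjugate f) = f)
    {x y : M} : (y : E) ∈ subdifferential (conjugate f) x ↔ (x : E) ∈ subdifferential f y := by
  rw [mem_subdifferential_iff, mem_subdifferential_iff, ← conjugate_apply, ← conjugate_apply, hf,
    add_comm, real_inner_comm]

end Compact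

end Legendre

theorem tendsto_of_isMaximizer {T Y : Type*} [TopologicalSpace T] [TopologicalSpace Y]
    [CompactSpace Y] {F : T → Y → ℝ} (hF : Continuous (Function.uncurry F)) {t₀ : T} {y₀ : Y}
    (hy₀ : ∀ y ≠ y₀, F t₀ y < F t₀ y₀) {y : T → Y} (hy : ∀ t z, F t z ≤ F t (y t)) :
    Tendsto y (𝓝 t₀) (𝓝 y₀) := by
  refine tendsto_nhds.2 fun U hU hy₀U => ?_
  have hlt : ∀ᶠ t in 𝓝 t₀, ∀ z ∈ Uᶜ, F t z < F t y₀ := by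
    refine hU.isClosed_compl.isCompact.eventually_forall_of_forall_eventually fun z hz => ?_
    have hcont : Continuous fun p : T × Y => F p.1 y₀ :=
      hF.comp (continuous_fst.prodMk continuous_const)
    exact hF.continuousAt.eventually_lt hcont.continuousAt
      (hy₀ z fun h => hz (h ▸ hy₀U))
  filter_upwards [hlt] with t ht
  exact not_notMem.1 fun hyU => (ht _ hyU).not_ge (hy t y₀)

theorem isCompact_setOf_lipschitzWith_and_eq_zero {X : Type*} [PseudoMetricSpace X]
    (K : ℝ≥0) (x₀ : X) :
    IsCompact {f : C(X, ℝ) | LipschitzWith K f ∧ f x₀ = 0} := by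
  set S : Set C(X, ℝ) := {f | LipschitzWith K f ∧ f x₀ = 0}
  have himage : ContinuousMap.toFun '' S = {f | LipschitzWith K f} ∩ {f | f x₀ = 0} := by
    ext f
    exact ⟨fun ⟨_, hg, hgf⟩ => hgf ▸ hg, fun hf => ⟨⟨f, hf.1.continuous⟩, hf, rfl⟩⟩
  have hclosed : IsClosed (ContinuousMap.toFun '' S) := by
    rw [himage]
    exact (isClosed_setOfPred_lipschitzWith K).inter <|
      isClosed_eq (continuous_apply x₀) continuous_const
  have hbounded : ContinuousMap.toFun '' S ⊆ univ.pi fun x => closedBall 0 (K * dist x x₀) := by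
    rintro _ ⟨f, ⟨hf, hf₀⟩, rfl⟩ x -
    have := hf.dist_le_mul x x₀
    rwa [hf₀] at this
  refine ArzelaAscoli.isCompact_of_equicontinuous S ?_ ?_
  · exact (isCompact_univ_pi fun x => isCompact_closedBall _ _).of_isClosed_subset hclosed hbounded
  · exact (LipschitzWith.uniformEquicontinuous _ K fun f : S => f.2.1).equicontinuous

section Danskin

variable {E : Type*} [NormedAddCommGroup E] [InnerProductSpace ℝ E] {M : Set E} [CompactSpace M]
  [Nonempty M]

theorem lipschitzWith_legendre_add_smul (f g : C(M, ℝ)) (x : E) :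
    LipschitzWith ‖g‖₊ fun t : ℝ => legendre (f + t • g) x := by
  refine LipschitzWith.of_dist_le_mul fun s t => ?_
  calc dist (legendre (f + s • g) x) (legendre (f + t • g) x)
      ≤ dist (f + s • g) (f + t • g) := abs_legendre_sub_legendre_le _ _ x
    _ = ‖g‖ * dist s t := by
      rw [dist_add_left, dist_eq_norm, ← sub_smul, norm_smul, mul_comm, dist_eq_norm]

theorem hasDerivAt_legendre_add_smul (f g : C(M, ℝ)) {x : E} {y₀ : M}
    (hy₀ : ∀ y, x ∈ subdifferential f y → y = y₀) :
    HasDerivAt (fun t : ℝ => legendre (f + t • g) x) (-g y₀) 0 := by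
  choose y hy using fun t : ℝ => exists_mem_subdifferential (f + t • g) x
  have hval (t : ℝ) : legendre (f + t • g) x + (f (y t) + t * g (y t)) = ⟪x, (y t : E)⟫ :=
    mem_subdifferential_iff.1 (hy t)
  have hle (t : ℝ) (z : M) : ⟪x, (z : E)⟫ ≤ legendre (f + t • g) x + (f z + t * g z) :=
    inner_le_legendre_add (f + t • g) x z
  have hval₀ : legendre f x + f y₀ = ⟪x, (y₀ : E)⟫ := by
    obtain ⟨z, hz⟩ := exists_mem_subdifferential f x
    exact mem_subdifferential_iff.1 (hy₀ z hz ▸ hz)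
  have hlim : Tendsto y (𝓝 0) (𝓝 y₀) := by
    refine tendsto_of_isMaximizer (F := fun (t : ℝ) (z : M) => ⟪x, (z : E)⟫ - (f z + t * g z))
      (by fun_prop) (fun z hz => ?_) fun t z => by linarith [hval t, hle t z]
    have hlt : ⟪x, (z : E)⟫ < legendre f x + f z :=
      (inner_le_legendre_add f x z).lt_of_ne fun h => hz (hy₀ z (mem_subdifferential_iff.2 h.symm))
    linarith
  have hg : (fun t => g y₀ - g (y t)) =o[𝓝 0] fun _ => (1 : ℝ) := by
    rw [Asymptotics.isLittleO_one_iff]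
    simpa using ((g.continuous.tendsto y₀).comp hlim).const_sub (g y₀)
  rw [hasDerivAt_iff_isLittleO]
  refine Asymptotics.IsBigO.trans_isLittleO (Asymptotics.IsBigO.of_norm_le fun t => ?_)
    (by simpa using (Asymptotics.isBigO_refl (fun t : ℝ => t) (𝓝 0)).mul_isLittleO hg)
  -- comparing the maximizers `y t` and `y₀` gives `0 ≤ L t - L 0 + t * g y₀ ≤ t * (g y₀ - g (y t))`
  have hlower := hle t y₀
  have hupper := inner_le_legendre_add f x (y t)
  have hvalt := hval t
  simp only [sub_zero, zero_smul, add_zero, smul_eq_mul]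
  rw [Real.norm_of_nonneg (by linarith)]
  linarith

end Danskin

theorem integrable_continuousMap {X : Type*} [TopologicalSpace X] [CompactSpace X]
    [MeasurableSpace X] [OpensMeasurableSpace X] {ν : Measure X} [IsFiniteMeasureOnCompacts ν]
    (f : C(X, ℝ)) : Integrable f ν :=
  f.continuous.integrable_of_hasCompactSupport (HasCompactSupport.of_compactSpace f)

section DualProblem

variable {E : Type*} [NormedAddCommGroup E] [InnerProductSpace ℝ E] [MeasurableSpace E]
  [BorelSpace E] {M : Set E} [CompactSpace M] [Nonempty M]

/-- The functional minimised in the dual optimal transport problem for the cost `-⟪x, y⟫`, reduced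
to its second potential. -/
noncomputable def dualFunctional (m : Measure E) (ν : Measure M) (f : C(M, ℝ)) : ℝ :=
  ∫ x, legendre f x ∂m + ∫ y, f y ∂ν

variable {m : Measure E} {ν : Measure M}

theorem integrable_legendre [IsFiniteMeasureOnCompacts m] (hm : ∀ᵐ x ∂m, x ∈ M) (f : C(M, ℝ)) :
    Integrable (legendre f) m := by
  have hM : IsCompact M := isCompact_iff_compactSpace.2 ‹CompactSpace M›
  have h := (continuous_legendre f).continuousOn.integrableOn_compact (μ := m) hM
  rwa [IntegrableOn, Measure.restrict_eq_self_of_ae_mem hm] at h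

variable [IsProbabilityMeasure m] [IsProbabilityMeasure ν]

theorem dualFunctional_le_add (hm : ∀ᵐ x ∂m, x ∈ M) {f g : C(M, ℝ)} {c d : ℝ}
    (hc : ∀ᵐ x ∂m, legendre f x ≤ legendre g x + c) (hd : ∀ y, f y ≤ g y + d) :
    dualFunctional m ν f ≤ dualFunctional m ν g + (c + d) := by
  have hlegendre := integral_mono_ae (integrable_legendre hm f)
    ((integrable_legendre hm g).add (integrable_const c)) hc
  have hfun := integral_mono (integrable_continuousMap (ν := ν) f)
    ((integrable_continuousMap g).add (integrable_const d)) hd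
  simp only [Pi.add_apply] at hlegendre hfun
  rw [integral_add (integrable_legendre hm g) (integrable_const c)] at hlegendre
  rw [integral_add (integrable_continuousMap g) (integrable_const d)] at hfun
  simp only [integral_const, probReal_univ, one_smul] at hlegendre hfun
  simp only [dualFunctional]
  linarith

theorem continuous_dualFunctional (hm : ∀ᵐ x ∂m, x ∈ M) : Continuous (dualFunctional m ν) := by
  refine (LipschitzWith.of_le_add_mul 2 fun f g => ?_).continuous
  have hfg (y : M) : f y ≤ g y + dist f g := by
    have := (abs_le.1 (ContinuousMap.dist_apply_le_dist (f := f) (g := g) y)).2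
    linarith
  rw [NNReal.coe_ofNat, two_mul]
  exact dualFunctional_le_add hm (.of_forall (legendre_le_legendre_add_dist f g)) hfg

theorem exists_lipschitzWith_dualFunctional_le (hm : ∀ᵐ x ∂m, x ∈ M) {R : ℝ≥0}
    (hR : ∀ f : C(M, ℝ), LipschitzWith R (legendre f)) (y₀ : M) (f : C(M, ℝ)) :
    ∃ g : C(M, ℝ), LipschitzWith R g ∧ g y₀ = 0 ∧
      dualFunctional m ν g ≤ dualFunctional m ν f := by
  set b := conjugate (conjugate f)
  refine ⟨b - .const M (b y₀), ?_, sub_self _, ?_⟩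
  · refine LipschitzWith.of_dist_le_mul fun y z => ?_
    simp only [ContinuousMap.coe_sub, Pi.sub_apply, ContinuousMap.const_apply, dist_sub_right]
    exact (hR (conjugate f)).dist_le_mul (y : E) z
  · have hlegendre : ∀ᵐ x ∂m, legendre (b - ContinuousMap.const M (b y₀)) x
        ≤ legendre f x + b y₀ := by
      filter_upwards [hm] with x hx
      refine legendre_le fun y => ?_
      have hb : legendre b x = legendre f x :=
        DFunLike.congr_fun (conjugate_conjugate_conjugate f) ⟨x, hx⟩
      have := inner_le_legendre_add b x y
      simp only [ContinuousMap.coe_sub, Pi.sub_apply, ContinuousMap.const_apply]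
      linarith
    have hfun (y : M) : (b - ContinuousMap.const M (b y₀)) y ≤ f y + -b y₀ :=
      add_le_add_left (conjugate_conjugate_le f y) _
    simpa using dualFunctional_le_add (ν := ν) hm hlegendre hfun

theorem exists_forall_dualFunctional_le (hm : ∀ᵐ x ∂m, x ∈ M) :
    ∃ f : C(M, ℝ), ∀ g, dualFunctional m ν f ≤ dualFunctional m ν g := by
  obtain ⟨R, hR⟩ := exists_forall_lipschitzWith_legendre (M := M)
  let y₀ : M := Classical.arbitrary M
  obtain ⟨f, -, hf⟩ := (isCompact_setOf_lipschitzWith_and_eq_zero R y₀).exists_isMinOn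
    ⟨0, LipschitzWith.const' 0, rfl⟩ (continuous_dualFunctional (m := m) (ν := ν) hm).continuousOn
  refine ⟨f, fun g => ?_⟩
  obtain ⟨g', hg'lip, hg'zero, hg'le⟩ :=
    exists_lipschitzWith_dualFunctional_le (m := m) (ν := ν) hm hR y₀ g
  exact (hf ⟨hg'lip, hg'zero⟩).trans hg'le

end DualProblem

theorem ae_restrict_fderivWithin_eq_fderiv {E : Type*} [NormedAddCommGroup E] [NormedSpace ℝ E]
    [FiniteDimensional ℝ E] [MeasurableSpace E] [BorelSpace E] (μ : Measure E) [μ.IsAddHaarMeasure]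
    {s : Set E} (hs : MeasurableSet s) (f : E → ℝ) :
    ∀ᵐ x ∂μ.restrict s, DifferentiableAt ℝ f x → fderivWithin ℝ f s x = fderiv ℝ f x := by
  classical
  rcases subsingleton_or_nontrivial E with _ | _
  · exact .of_forall fun x _ => Subsingleton.elim _ _
  obtain ⟨v, hv⟩ := exists_ne (0 : E)
  -- every `L x` is a derivative of the zero function within `s`, so it vanishes at density points
  let L (x : E) : E →L[ℝ] ℝ :=
    if DifferentiableAt ℝ f x then fderivWithin ℝ f s x - fderiv ℝ f x else 0
  have hL (x : E) : HasFDerivWithinAt (fun _ => (0 : ℝ)) (L x) s x := by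
    by_cases hd : DifferentiableAt ℝ f x
    · simpa only [L, hd, if_true, sub_self] using
        hd.differentiableWithinAt.hasFDerivWithinAt.fun_sub hd.hasFDerivAt.hasFDerivWithinAt
    · simpa only [L, hd, if_false] using hasFDerivWithinAt_const (0 : ℝ) x s
  have hLv (x : E) : HasFDerivWithinAt (fun _ => (0 : ℝ) • v) ((L x).smulRight v) s x :=
    (hL x).smul_const v
  have happrox : ApproximatesLinearOn (fun _ : E => (0 : ℝ) • v) (0 : E →L[ℝ] E) s 0 := by
    simp [ApproximatesLinearOn]
  filter_upwards [happrox.norm_fderiv_sub_le μ hs _ fun x _ => hLv x] with x hx hd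
  have hzero : L x = 0 := by simpa [hv] using hx
  simpa only [L, hd, if_true, sub_eq_zero] using hzero

section Transport

variable {E : Type*} [NormedAddCommGroup E] [InnerProductSpace ℝ E] [FiniteDimensional ℝ E]
  [MeasurableSpace E] [BorelSpace E] {M : Set E} {m : Measure E}

theorem measurable_gradient (u : E → ℝ) : Measurable (gradient u) :=
  (InnerProductSpace.toDual ℝ E).symm.continuous.measurable.comp (measurable_fderiv ℝ u)

theorem ae_mem_interior_of_convex (hm : m ≪ volume) {s : Set E} (hs : Convex ℝ s) :
    ∀ᵐ x ∂m, x ∈ s → x ∈ interior s := by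
  filter_upwards [measure_eq_zero_iff_ae_notMem.1 (hm (hs.addHaar_frontier volume))] with x hx hxs
  exact not_not.1 fun hxi => hx ⟨subset_closure hxs, hxi⟩

variable [CompactSpace M] [Nonempty M]

theorem ae_gradient_legendre_eq (hm : m ≪ volume) (f : C(M, ℝ)) :
    ∀ᵐ x ∂m, ∀ y, x ∈ subdifferential f y → gradient (legendre f) x = y := by
  obtain ⟨R, hR⟩ := exists_forall_lipschitzWith_legendre (M := M)
  filter_upwards [hm.ae_le (hR f).ae_differentiableAt] with x hd y hy
  exact gradient_legendre_eq hy hd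

theorem ae_exists_gradient_legendre_eq (hm : m ≪ volume) (f : C(M, ℝ)) :
    ∀ᵐ x ∂m, ∃ y : M, x ∈ subdifferential f y ∧ gradient (legendre f) x = y := by
  filter_upwards [ae_gradient_legendre_eq hm f] with x hx
  obtain ⟨y, hy⟩ := exists_mem_subdifferential f x
  exact ⟨y, hy, hx y hy⟩

section Existence

theorem hasDerivAt_integral_legendre_add_smul [IsFiniteMeasure m] (hm : m ≪ volume)
    (hmM : ∀ᵐ x ∂m, x ∈ M) (f : C(M, ℝ)) (g : C(E, ℝ)) :
    HasDerivAt (fun t : ℝ => ∫ x, legendre (f + t • g.restrict M) x ∂m)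
      (∫ x, -g (gradient (legendre f) x) ∂m) 0 := by
  refine (hasDerivAt_integral_of_dominated_loc_of_lip univ_mem
    (.of_forall fun t => (integrable_legendre hmM _).1) (integrable_legendre hmM _)
    (g.continuous.neg.measurable.comp (measurable_gradient _)).aestronglyMeasurable
    (.of_forall fun x => ?_) (integrable_const ‖g.restrict M‖) ?_).2
  · rw [Real.nnabs_of_nonneg (norm_nonneg _), lipschitzOnWith_univ, norm_toNNReal]
    exact lipschitzWith_legendre_add_smul f (g.restrict M) x
  · filter_upwards [ae_gradient_legendre_eq hm f] with x hx
    obtain ⟨y, hy⟩ := exists_mem_subdifferential f x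
    have hderiv := hasDerivAt_legendre_add_smul f (g.restrict M) fun z hz =>
      Subtype.ext ((hx z hz).symm.trans (hx y hy))
    rwa [Function.comp_apply, Pi.neg_apply, hx y hy]

variable {ν : Measure M}

/-- The Euler–Lagrange equation of the dual problem. -/
theorem integral_comp_gradient_legendre_eq [IsFiniteMeasure m] [IsFiniteMeasure ν]
    (hm : m ≪ volume) (hmM : ∀ᵐ x ∂m, x ∈ M) {f : C(M, ℝ)}
    (hf : ∀ g, dualFunctional m ν f ≤ dualFunctional m ν g) (g : C(E, ℝ)) :
    ∫ x, g (gradient (legendre f) x) ∂m = ∫ y : M, g y ∂ν := by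
  set gM : C(M, ℝ) := g.restrict M
  have hlinear (t : ℝ) : ∫ y, (f + t • gM) y ∂ν = ∫ y, f y ∂ν + t * ∫ y, gM y ∂ν := by
    rw [← integral_const_mul]
    exact integral_add (integrable_continuousMap f) ((integrable_continuousMap gM).const_mul t)
  have hderiv : HasDerivAt (fun t : ℝ => ∫ y, (f + t • gM) y ∂ν) (∫ y, gM y ∂ν) 0 := by
    simpa only [hlinear, one_mul] using
      ((hasDerivAt_id' (0 : ℝ)).mul_const _).const_add (∫ y, f y ∂ν)
  have hmin : IsLocalMin (fun t : ℝ => dualFunctional m ν (f + t • gM)) 0 :=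
    .of_forall fun t => by simpa only [zero_smul, add_zero] using hf (f + t • gM)
  have hzero :=
    hmin.hasDerivAt_eq_zero ((hasDerivAt_integral_legendre_add_smul hm hmM f g).add hderiv)
  rw [integral_neg] at hzero
  exact neg_add_eq_zero.1 hzero

theorem exists_map_gradient_legendre_eq [IsProbabilityMeasure m] [IsProbabilityMeasure ν]
    (hm : m ≪ volume) (hmM : ∀ᵐ x ∂m, x ∈ M) :
    ∃ f : C(M, ℝ), m.map (gradient (legendre f)) = ν.map Subtype.val := by
  obtain ⟨f, hf⟩ := exists_forall_dualFunctional_le (ν := ν) hmM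
  have hgrad := measurable_gradient (legendre f)
  refine ⟨f, ext_of_forall_integral_eq_of_IsFiniteMeasure fun g => ?_⟩
  rw [integral_map hgrad.aemeasurable g.continuous.aestronglyMeasurable,
    integral_map measurable_subtype_coe.aemeasurable g.continuous.aestronglyMeasurable]
  exact integral_comp_gradient_legendre_eq hm hmM hf g.toContinuousMap

end Existence

section Conjugate

variable [NullSingletonClass m]

theorem measure_support_map_gradient_legendre_conjugate_eq_zero (hm : m ≪ volume)
    (hmM : ∀ᵐ x ∂m, x ∈ M) {f : C(M, ℝ)} (hf : conjugate (conjugate f) = f) {D : Set E}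
    (hD : D.Countable) (hfD : ∀ᵐ x ∂m, gradient (legendre f) x ∈ D) :
    m (m.map (gradient (legendre (conjugate f)))).support = 0 := by
  set O : Set E := ⋃ z ∈ {z : M | (z : E) ∈ D}, interior (subdifferential f z)
  have hD' : {z : M | (z : E) ∈ D}.Countable := hD.preimage Subtype.val_injective
  have hOopen : IsOpen O := isOpen_biUnion fun _ _ => isOpen_interior
  have hOfull : ∀ᵐ x ∂m, x ∈ O := by
    filter_upwards [hfD, ae_exists_gradient_legendre_eq hm f, (ae_ball_iff hD').2 fun z _ =>
      ae_mem_interior_of_convex hm (convex_subdifferential f z)] with x hxD ⟨z, hxz, hz⟩ hint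
    rw [hz] at hxD
    exact mem_biUnion hxD (hint z hxD hxz)
  have hOavoid : ∀ᵐ y ∂m, gradient (legendre (conjugate f)) y ∉ O := by
    filter_upwards [hmM, hD.ae_notMem m, ae_exists_gradient_legendre_eq hm (conjugate f)]
      with y hyM hyD ⟨x, hyx, hx⟩ hxO
    rw [hx] at hxO
    obtain ⟨z, hzD, hxz⟩ := mem_iUnion₂.1 hxO
    have hxy : (x : E) ∈ subdifferential f ⟨y, hyM⟩ :=
      (mem_subdifferential_conjugate_iff hf).1 hyx
    obtain rfl := eq_of_mem_interior_subdifferential hxz hxy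
    exact hyD hzD
  have hOnull : m.map (gradient (legendre (conjugate f))) O = 0 := by
    rw [Measure.map_apply (measurable_gradient _) hOopen.measurableSet]
    exact measure_eq_zero_iff_ae_notMem.2 hOavoid
  exact measure_mono_null
    (subset_compl_comm.1 (Measure.subset_compl_support_of_isOpen hOopen hOnull)) hOfull

theorem map_gradient_legendre_conjugate_singleton_eq_zero (hm : m ≪ volume)
    (hmM : ∀ᵐ x ∂m, x ∈ M) {f : C(M, ℝ)} (hf : conjugate (conjugate f) = f)
    (hsupp : M ⊆ (m.map (gradient (legendre f))).support) (x : E) :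
    m.map (gradient (legendre (conjugate f))) {x} = 0 := by
  rw [Measure.map_apply (measurable_gradient _) (measurableSet_singleton x),
    measure_eq_zero_iff_ae_notMem]
  by_cases hxM : x ∈ M
  · lift x to M using hxM
    set V : Set E := interior (subdifferential (conjugate f) x)
    have hVavoid : ∀ᵐ x' ∂m, gradient (legendre f) x' ∉ V := by
      filter_upwards [hmM, (countable_singleton (x : E)).ae_notMem m,
        ae_exists_gradient_legendre_eq hm f] with x' hx'M hne ⟨y, hx'y, hy⟩ hyV
      rw [hy] at hyV
      have hyx' : (y : E) ∈ subdifferential (conjugate f) ⟨x', hx'M⟩ :=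
        (mem_subdifferential_conjugate_iff hf).2 hx'y
      exact hne (congr_arg Subtype.val (eq_of_mem_interior_subdifferential hyV hyx'))
    have hVnull : m.map (gradient (legendre f)) V = 0 := by
      rw [Measure.map_apply (measurable_gradient _) isOpen_interior.measurableSet]
      exact measure_eq_zero_iff_ae_notMem.2 hVavoid
    have hVM := Measure.subset_compl_support_of_isOpen isOpen_interior hVnull
    filter_upwards [hmM, ae_exists_gradient_legendre_eq hm (conjugate f),
      ae_mem_interior_of_convex hm (convex_subdifferential (conjugate f) x)]
      with y hyM ⟨z, hyz, hz⟩ hyV hzx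
    obtain rfl : z = x := Subtype.ext (hz.symm.trans hzx)
    exact hVM (hyV hyz) (hsupp hyM)
  · filter_upwards [ae_exists_gradient_legendre_eq hm (conjugate f)] with y ⟨z, _, hz⟩ hzx
    exact hxM (hzx ▸ hz ▸ z.2)

end Conjugate

end Transport

theorem eq_zero_of_le_of_absolutelyContinuous {X : Type*} [TopologicalSpace X]
    [HereditarilyLindelofSpace X] [MeasurableSpace X] {m ρ ν : Measure X} (hρ : m ρ.support = 0)
    (hνρ : ν ≤ ρ) (hνm : ν ≪ m) : ν = 0 := by
  rw [← Measure.measure_univ_eq_zero, ← union_compl_self ρ.support]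
  exact measure_union_null (hνm hρ)
    (nonpos_iff_eq_zero.1 ((hνρ _).trans_eq Measure.measure_compl_support))

theorem hasGradientAt_half_norm_sq {E : Type*} [NormedAddCommGroup E] [InnerProductSpace ℝ E]
    [CompleteSpace E] (x : E) : HasGradientAt (fun x : E => ‖x‖ ^ 2 / 2) x x := by
  have h := (hasStrictFDerivAt_norm_sq x).hasFDerivAt.const_mul (2⁻¹ : ℝ)
  rw [← Nat.cast_smul_eq_nsmul ℝ, Nat.cast_ofNat, inv_smul_smul₀ two_ne_zero] at h
  simp only [hasGradientAt_iff_hasFDerivAt, div_eq_inv_mul]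
  exact h

section Potential

variable {n : ℕ} {M : Set (EuclideanSpace ℝ (Fin n))}

theorem isGLB_half_dist_sq_add_iff {φ : EuclideanSpace ℝ (Fin n) → ℝ} {f : M → ℝ}
    (hf : ∀ y : M, f y = φ y + ‖y.1‖ ^ 2 / 2) {x : EuclideanSpace ℝ (Fin n)} {a : ℝ} :
    IsGLB ((fun y => dist x y ^ 2 / 2 + φ y) '' M) (-a) ↔
      IsLUB (range fun y : M => ⟪x, y.1⟫ - f y) (a + ‖x‖ ^ 2 / 2) := by
  have hneg : (fun y : M => ⟪x, y.1⟫ - f y) =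
      fun y : M => ‖x‖ ^ 2 / 2 - (dist x y ^ 2 / 2 + φ y) := by
    ext y
    rw [hf, dist_eq_norm, norm_sub_sq_real]
    ring
  have hbound (b : ℝ) : b ∈ lowerBounds ((fun y => dist x y ^ 2 / 2 + φ y) '' M) ↔
      ‖x‖ ^ 2 / 2 - b ∈ upperBounds (range fun y : M => ⟪x, y.1⟫ - f y) := by
    simp only [hneg, mem_lowerBounds, mem_upperBounds, forall_mem_image, forall_mem_range,
      Subtype.forall, sub_le_sub_iff_left]
  rw [isGLB_iff_le_iff, isLUB_iff_le_iff, ← (Equiv.subLeft (‖x‖ ^ 2 / 2)).forall_congr_right]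
  refine forall_congr' fun b => ?_
  have hle : ‖x‖ ^ 2 / 2 - b ≤ -a ↔ a + ‖x‖ ^ 2 / 2 ≤ b := by
    constructor <;> intro h <;> linarith
  rw [Equiv.subLeft_apply, hbound, sub_sub_cancel, hle]

theorem isHalfSqDistConvex_legendre_sub [CompactSpace M] (f : C(M, ℝ)) :
    IsHalfSqDistConvex M fun x => legendre f x - ‖x‖ ^ 2 / 2 := by
  let ψ : EuclideanSpace ℝ (Fin n) → ℝ := Function.extend Subtype.val
    (fun y : M => f y - ‖y.1‖ ^ 2 / 2) 0
  have hψ (y : M) : f y = ψ y + ‖y.1‖ ^ 2 / 2 := by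
    simp only [ψ, Subtype.val_injective.extend_apply, sub_add_cancel]
  refine ⟨ψ, fun x hx => (isGLB_half_dist_sq_add_iff hψ).2 ?_⟩
  have : Nonempty M := ⟨⟨x, hx⟩⟩
  rw [sub_add_cancel]
  exact isLUB_ciSup (bddAbove_range_inner_sub f x)

theorem exists_eq_legendre_of_isHalfSqDistConvex [CompactSpace M] [Nonempty M]
    {φ : EuclideanSpace ℝ (Fin n) → ℝ} (hφ : IsHalfSqDistConvex M φ) :
    ∃ f : C(M, ℝ), conjugate (conjugate f) = f ∧ (∀ x ∈ M, φ x = legendre f x - ‖x‖ ^ 2 / 2) ∧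
      ∀ y, conjFun M φ y = legendre (conjugate f) y - ‖y‖ ^ 2 / 2 := by
  obtain ⟨ψ, hψ⟩ := hφ
  let f (y : M) : ℝ := ψ y + ‖y.1‖ ^ 2 / 2
  have hlub (x : M) : IsLUB (range fun y : M => ⟪x.1, y.1⟫ - f y) (φ x + ‖x.1‖ ^ 2 / 2) :=
    (isGLB_half_dist_sq_add_iff fun _ => rfl).1 (hψ x x.2)
  have hM : IsCompact M := isCompact_iff_compactSpace.2 ‹CompactSpace M›
  obtain ⟨R, hR0, hR⟩ := hM.isBounded.subset_closedBall_lt 0 0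
  have hlip : LipschitzOnWith ⟨R, hR0.le⟩ (legendre f) M :=
    lipschitzOnWith_legendre hR fun x hx => (hlub ⟨x, hx⟩).bddAbove
  let p : C(M, ℝ) := ⟨M.domRestrict (legendre f), hlip.continuousOn.domRestrict⟩
  have hp (x : M) : p x = φ x + ‖x.1‖ ^ 2 / 2 := (hlub x).ciSup_eq
  have hpp : conjugate (conjugate p) = p :=
    conjugate_conjugate_of_isLUB fun x => (hp x).symm ▸ hlub x
  refine ⟨conjugate p, conjugate_conjugate_conjugate p, fun x hx => ?_, fun y => ?_⟩
  · have hx' : legendre (conjugate p) x = p ⟨x, hx⟩ := DFunLike.congr_fun hpp ⟨x, hx⟩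
    rw [hx', hp, add_sub_cancel_right]
  · have hglb : IsGLB ((fun x => dist y x ^ 2 / 2 + φ x) '' M)
        (-(legendre p y - ‖y‖ ^ 2 / 2)) := by
      rw [isGLB_half_dist_sq_add_iff hp, sub_add_cancel]
      exact isLUB_ciSup (bddAbove_range_inner_sub p y)
    rw [hpp, conjFun, hglb.csInf_eq ((nonempty_coe_sort.1 ‹_›).image _), neg_neg]

variable {m μ : Measure (EuclideanSpace ℝ (Fin n))}

theorem expGrad_ae_eq_gradient (hm : m ≪ volume) (hM : MeasurableSet M) (hmM : ∀ᵐ x ∂m, x ∈ M)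
    {φ u : EuclideanSpace ℝ (Fin n) → ℝ} (hφ : ∀ x ∈ M, φ x = u x - ‖x‖ ^ 2 / 2) {R : ℝ≥0}
    (hu : LipschitzWith R u) : expGrad M φ =ᵐ[m] gradient u := by
  have hfderiv := (hm.restrict M).ae_le
    (ae_restrict_fderivWithin_eq_fderiv volume hM fun x => u x - ‖x‖ ^ 2 / 2)
  rw [Measure.restrict_eq_self_of_ae_mem hmM] at hfderiv
  filter_upwards [hmM, hm.ae_le hu.ae_differentiableAt, hfderiv] with x hx hdu hxM
  have hgrad := hdu.hasGradientAt.hasFDerivAt.fun_sub (hasGradientAt_half_norm_sq x).hasFDerivAt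
  rw [← map_sub] at hgrad
  have hwithin : gradientWithin φ M x = gradient (fun x => u x - ‖x‖ ^ 2 / 2) x := by
    rw [gradientWithin, fderivWithin_congr hφ (hφ x hx), hxM hgrad.differentiableAt, gradient]
  rw [expGrad, hwithin, (hasGradientAt_iff_hasFDerivAt.2 hgrad).gradient, add_sub_cancel]

variable [CompactSpace M] [Nonempty M]

theorem exists_isHalfSqDistConvex_map_expGrad_eq [IsProbabilityMeasure m] [IsProbabilityMeasure μ]
    (hm : m ≪ volume) (hmM : ∀ᵐ x ∂m, x ∈ M) (hμM : ∀ᵐ y ∂μ, y ∈ M) :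
    ∃ φ, IsHalfSqDistConvex M φ ∧ m.map (expGrad M φ) = μ := by
  have hM : MeasurableSet M := (isCompact_iff_compactSpace.2 ‹CompactSpace M›).measurableSet
  have hμmap : (μ.comap ((↑) : M → EuclideanSpace ℝ (Fin n))).map (↑) = μ := by
    rw [map_comap_subtype_coe hM, Measure.restrict_eq_self_of_ae_mem hμM]
  have : IsProbabilityMeasure (μ.comap ((↑) : M → EuclideanSpace ℝ (Fin n))) := by
    rw [← Measure.isProbabilityMeasure_map_iff measurable_subtype_coe.aemeasurable, hμmap]
    infer_instance
  obtain ⟨f, hf⟩ := exists_map_gradient_legendre_eq (ν := μ.comap (↑)) hm hmM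
  obtain ⟨R, hR⟩ := exists_forall_lipschitzWith_legendre (M := M)
  refine ⟨_, isHalfSqDistConvex_legendre_sub f, ?_⟩
  rw [Measure.map_congr (expGrad_ae_eq_gradient hm hM hmM (fun _ _ => rfl) (hR f)), hf, hμmap]

theorem brenierPotential_spec [IsProbabilityMeasure m] [IsProbabilityMeasure μ]
    (hm : m ≪ volume) (hmM : ∀ᵐ x ∂m, x ∈ M) (hμM : ∀ᵐ y ∂μ, y ∈ M) :
    IsHalfSqDistConvex M (brenierPotential M m μ) ∧
      m.map (expGrad M (brenierPotential M m μ)) = μ :=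
  Classical.epsilon_spec (exists_isHalfSqDistConvex_map_expGrad_eq hm hmM hμM)

theorem exists_map_expGrad_eq_map_gradient_legendre (hm : m ≪ volume) (hmM : ∀ᵐ x ∂m, x ∈ M)
    {φ : EuclideanSpace ℝ (Fin n) → ℝ} (hφ : IsHalfSqDistConvex M φ) :
    ∃ f : C(M, ℝ), conjugate (conjugate f) = f ∧
      m.map (expGrad M φ) = m.map (gradient (legendre f)) ∧
      m.map (expGrad M (conjFun M φ)) = m.map (gradient (legendre (conjugate f))) := by
  have hM : MeasurableSet M := (isCompact_iff_compactSpace.2 ‹CompactSpace M›).measurableSet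
  obtain ⟨f, hf, hφf, hconj⟩ := exists_eq_legendre_of_isHalfSqDistConvex hφ
  obtain ⟨R, hR⟩ := exists_forall_lipschitzWith_legendre (M := M)
  exact ⟨f, hf, Measure.map_congr (expGrad_ae_eq_gradient hm hM hmM hφf (hR f)),
    Measure.map_congr (expGrad_ae_eq_gradient hm hM hmM (fun y _ => hconj y) (hR (conjugate f)))⟩

end Potential

theorem exists_countable_of_isDiscreteMeasure {n : ℕ} {μ : Measure (EuclideanSpace ℝ (Fin n))}
    (hμ : IsDiscreteMeasure μ) : ∃ D : Set (EuclideanSpace ℝ (Fin n)), D.Countable ∧ μ Dᶜ = 0 := by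
  obtain ⟨c, z, rfl⟩ := hμ
  have hD := (countable_range z).measurableSet.compl
  refine ⟨range z, countable_range z, ?_⟩
  simp [Measure.sum_apply _ hD, Measure.dirac_apply' _ hD]

theorem corollary4p3_general {n : ℕ} (hn : 1 ≤ n) {M : Set (EuclideanSpace ℝ (Fin n))}
    (hM : IsCompact M) {m : Measure (EuclideanSpace ℝ (Fin n))} [IsProbabilityMeasure m]
    (hm_ac : m ≪ volume) (hmM : ∀ᵐ x ∂m, x ∈ M) {μ : Measure (EuclideanSpace ℝ (Fin n))}
    {φ : EuclideanSpace ℝ (Fin n) → ℝ} (hφ : IsHalfSqDistConvex M φ)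
    (hφμ : m.map (expGrad M φ) = μ) :
    (IsDiscreteMeasure μ →
      m (m.map (expGrad M (conjFun M φ))).support = 0 ∧
      ∀ ν : Measure (EuclideanSpace ℝ (Fin n)),
        ν ≤ m.map (expGrad M (conjFun M φ)) → ν ≪ m → ν = 0) ∧
    (μ.support = M →
      ∀ x : EuclideanSpace ℝ (Fin n), m.map (expGrad M (conjFun M φ)) {x} = 0) := by
  have : Nonempty (Fin n) := ⟨⟨0, hn⟩⟩
  have : CompactSpace M := isCompact_iff_compactSpace.1 hM
  have : Nonempty M := nonempty_subtype.2 hmM.exists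
  have : NullSingletonClass m := ⟨fun x => hm_ac (measure_singleton x)⟩
  obtain ⟨f, hf, hφf, hconj⟩ := exists_map_expGrad_eq_map_gradient_legendre hm_ac hmM hφ
  rw [hconj]
  subst hφμ
  rw [hφf]
  refine ⟨fun hdisc => ?_, fun hsupp =>
    map_gradient_legendre_conjugate_singleton_eq_zero hm_ac hmM hf hsupp.ge⟩
  obtain ⟨D, hD, hμD⟩ := exists_countable_of_isDiscreteMeasure hdisc
  have hfD : ∀ᵐ x ∂m, gradient (legendre f) x ∈ D :=
    ae_of_ae_map (measurable_gradient _).aemeasurable hμD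
  have hnull := measure_support_map_gradient_legendre_conjugate_eq_zero hm_ac hmM hf hD hfD
  exact ⟨hnull, fun _ => eq_zero_of_le_of_absolutelyContinuous hnull⟩

theorem corollary4p3 (n : ℕ) (hn : 1 ≤ n)
    (M : Set (EuclideanSpace ℝ (Fin n))) (hMcompact : IsCompact M) (hMconvex : Convex ℝ M)
    (m : Measure (EuclideanSpace ℝ (Fin n))) [IsProbabilityMeasure m]
    (hm_ac : m ≪ volume) (hm_supp : m.support = M)
    (μ : Measure (EuclideanSpace ℝ (Fin n))) [IsProbabilityMeasure μ] (hμ : μ Mᶜ = 0) :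
    (IsDiscreteMeasure μ →
      m (conjMeasure M m μ).support = 0 ∧
      ∀ ν : Measure (EuclideanSpace ℝ (Fin n)), ν ≤ conjMeasure M m μ → ν ≪ m → ν = 0) ∧
    (μ.support = M → ∀ x : EuclideanSpace ℝ (Fin n), conjMeasure M m μ {x} = 0) := by
  have hmM : ∀ᵐ x ∂m, x ∈ M := hm_supp ▸ Measure.measure_compl_support
  have : CompactSpace M := isCompact_iff_compactSpace.1 hMcompact
  have : Nonempty M := nonempty_subtype.2 hmM.exists
  obtain ⟨hφ, hφμ⟩ := brenierPotential_spec hm_ac hmM hμ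
  exact corollary4p3_general hn hMcompact hm_ac hmM hφ hφμ
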